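/- Let $[m]=\{1,\dots,m\}$. For $n\ge 1$ let $\mathcal A_{3n}$ be the set of permutations $\pi=\pi_1\pi_2\cdots\pi_{3n}$ of $[3n]$ such that - every cycle of $\pi$ has length exactly $3$ (so $\pi$ is a product of $n$ disjoint $3$-cycles and has no fixed points); - $\pi$ avoids the pattern $132$, i.e. there are no positions $i<j<k$ with $\pi_i<\pi_k<\pi_j$; - every $3$-cycle of $\pi$ is of the form $312$, i.e. if the elements of the cycle are $a<b<c$, then $\pi_a\pi_b\pi_c$ is in the same relative order as $312$ (equivalently, $\pi_a=c$, $\pi_b=a$, $\pi_c=b$). Let $C_j$ denote the $j$-th Catalan number and $M_j$ the $j$-th Motzkin number, that is, the number of lattice paths from $(0,0)$ to $(j,0)$ with steps $(1,1)$, $(1,0)$, $(1,-1)$ that never go below the $x$-axis. Let $c(x)=\sum_{j\ge 0}C_jx^j$ and $m(x)=\sum_{j\ge 0}M_jx^j$ be their generating functions, and let $\mathcal P_{n,k}$ be the set of compositions of $n$ of length $k$, i.e. of sequences $(x_1,\dots,x_k)$ of positive integers with $x_1+\cdots+x_k=n$. Then for all $n\ge 1$, $$|\mathcal A_{3n}|=\sum_{k=1}^{n}M_{k-1}\sum_{(x_1,\dots,x_k)\in\mathcal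 P_{n,k}}C_{x_1}C_{x_2}\cdots C_{x_k}.$$ Furthermore, the generating function $A(x)=\sum_{n\ge 1}|\mathcal A_{3n}|x^n$ satisfies, as an identity of formal power series, $$A(x)=(c(x)-1)\,m(c(x)-1).$$ -/

import Mathlib

/-- `IsOccurrence π σ f`: the subsequence of (the one-line notation of) the permutation `π` of an
`n`-element chain read at the positions `f 0 < f 1 < ⋯ < f (k - 1)` is in the same relative order
as the word `σ 0, σ 1, …, σ (k - 1)`. -/
def IsOccurrence {n k : ℕ} (π : Equiv.Perm (Fin n)) (σ : Fin k → ℕ) (f : Fin k ↪o Fin n) : Prop :=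
  ∀ i j : Fin k, π (f i) < π (f j) ↔ σ i < σ j

/-- `π` avoids the pattern `σ`. -/
def AvoidsPattern {n k : ℕ} (π : Equiv.Perm (Fin n)) (σ : Fin k → ℕ) : Prop :=
  ∀ f : Fin k ↪o Fin n, ¬ IsOccurrence π σ f

/-- The cycle `c` of `π` is of the form `σ`: the elements of the cycle, read in `π` from left to
right, are an occurrence of the pattern `σ`. -/
def CycleHasForm {n k : ℕ} (π c : Equiv.Perm (Fin n)) (σ : Fin k → ℕ) : Prop :=
  ∃ f : Fin k ↪o Fin n, Set.range f = (c.support : Set (Fin n)) ∧ IsOccurrence π σ f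

/-- The permutations of a `3n`-element chain that are composed only of 3-cycles (`n` of them, so
that there is no fixed point). -/
def ThreeCyclePerms (n : ℕ) : Set (Equiv.Perm (Fin (3 * n))) :=
  {π | π.cycleType = Multiset.replicate n 3}

/-- The 132-avoiding permutations composed only of 3-cycles, all of them of the form 312. -/
def A (n : ℕ) : Set (Equiv.Perm (Fin (3 * n))) :=
  {π | π ∈ ThreeCyclePerms n ∧ AvoidsPattern π ![1, 3, 2] ∧
    ∀ c ∈ π.cycleFactorsFinset, CycleHasForm π c ![3, 1, 2]}

/-- The steps of a Motzkin path: up `(1, 1)`, flat `(1, 0)`, down `(1, -1)`. -/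
inductive MotzkinStep where
  | U
  | F
  | D

/-- The change of height along a step. -/
def MotzkinStep.rise : MotzkinStep → ℤ
  | U => 1
  | F => 0
  | D => -1

/-- A word of steps is a Motzkin path if it never goes below height `0` and ends at height `0`. -/
def IsMotzkinPath (w : List MotzkinStep) : Prop :=
  (∀ i : ℕ, 0 ≤ ((w.take i).map MotzkinStep.rise).sum) ∧ (w.map MotzkinStep.rise).sum = 0

/-- The Motzkin number `M_n`: the number of Motzkin paths of length `n`. -/
noncomputable def motzkin (n : ℕ) : ℕ :=
  {w : List MotzkinStep | w.length = n ∧ IsMotzkinPath w}.ncard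

/-- The compositions of `n` of length `k`. -/
def compositionsOfLength (n k : ℕ) : Finset (Composition n) :=
  Finset.univ.filter fun X => X.length = k

/-- The generating function `c(x)` of the Catalan numbers. -/
noncomputable def catalanGF : PowerSeries ℤ :=
  PowerSeries.mk fun n => (catalan n : ℤ)

/-- The generating function `m(x)` of the Motzkin numbers. -/
noncomputable def motzkinGF : PowerSeries ℤ :=
  PowerSeries.mk fun n => (motzkin n : ℤ)

/-- The generating function `A(x) = ∑_{n ≥ 1} |A n| xⁿ`; the sum starts at `n = 1`. -/
noncomputable def AGF : PowerSeries ℤ :=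
  PowerSeries.mk fun n => if n = 0 then 0 else ((A n).ncard : ℤ)

/-- `c(x) - 1` has no constant term, so that the composition `m(c(x) - 1)` makes sense. -/
theorem hasSubst_catalanGF_sub_one : PowerSeries.HasSubst (catalanGF - 1) := by
  apply PowerSeries.HasSubst.of_constantCoeff_zero'
  rw [map_sub, map_one, ← PowerSeries.coeff_zero_eq_constantCoeff_apply, catalanGF,
    PowerSeries.coeff_mk, catalan_zero, Nat.cast_one, sub_self]

/-! Every cycle of an element of `A n` is α ↦ γ ↦ β ↦ α with α < β < γ. Avoiding 132 forces the n
minima α to be the first n positions and makes β increase with γ. The permutation is therefore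
determined by the order σ of the minima, with cycles listed by increasing γ, and by the shuffle f of
the β's and γ's. The rest of the avoidance condition is `IsAdmissible σ f`, whence `ncard_A`.

Admissible pairs form a generating tree under prepending an entry (`isAdmissible_insertFirst`).
Label a pair by u = `coheight` and r = `cutRank`. The root has label (0, 1), and the children of (u,
r) are (i, r) for 2 ≤ i ≤ u + 1 and (1, i + 1) for 1 ≤ i ≤ r (`sum_extensions`).

Put T = (c - 1) m(c - 1). From c = 1 + xc² and T = xc(1 + T)² (`treeGF_eq`), the series c^u (1 +
T)^r equals 1 plus x times the sum of the same series over the children (`catalanGF_pow_mul_eq`). It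
thus counts the subtree below a node labelled (u, r) by depth, and the whole tree has series 1 + T.
Expanding T in powers of c - 1 gives the sum over compositions (`coeff_treeGF`). -/

/-! ### Motzkin numbers -/

/-- Motzkin words of length `n` that start at height `h`. -/
def motzkinPathsFrom (n h : ℕ) : Set (List MotzkinStep) :=
  {w | w.length = n ∧ (∀ i : ℕ, 0 ≤ (h : ℤ) + ((w.take i).map MotzkinStep.rise).sum) ∧
    (h : ℤ) + (w.map MotzkinStep.rise).sum = 0}

/-- The number of Motzkin words of length `n` that start at height `h`. -/
def motzkinFrom : ℕ → ℕ → ℕ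
  | 0, 0 => 1
  | 0, _ + 1 => 0
  | n + 1, 0 => motzkinFrom n 1 + motzkinFrom n 0
  | n + 1, h + 1 => motzkinFrom n (h + 2) + motzkinFrom n (h + 1) + motzkinFrom n h

theorem motzkinPathsFrom_zero_zero : motzkinPathsFrom 0 0 = {[]} := by
  ext w
  simp only [motzkinPathsFrom, List.length_eq_zero_iff, Set.mem_ofPred_eq, Set.mem_singleton_iff]
  constructor
  · exact fun h => h.1
  · rintro rfl
    simp

theorem motzkinPathsFrom_zero_succ (h : ℕ) : motzkinPathsFrom 0 (h + 1) = ∅ := by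
  ext w
  simp only [motzkinPathsFrom, List.length_eq_zero_iff, Set.mem_ofPred_eq, Set.mem_empty_iff_false,
    iff_false]
  rintro ⟨rfl, -, h3⟩
  simp at h3
  omega

theorem cons_mem_motzkinPathsFrom (s : MotzkinStep) (w : List MotzkinStep) (n h h' : ℕ)
    (hh : (h : ℤ) + s.rise = h') :
    s :: w ∈ motzkinPathsFrom (n + 1) h ↔ w ∈ motzkinPathsFrom n h' := by
  simp only [motzkinPathsFrom, List.length_cons, Nat.add_right_cancel_iff, Set.mem_ofPred_eq,
    List.map_cons, List.sum_cons, ← hh, ← add_assoc]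
  refine and_congr_right fun _ => and_congr_left fun _ => ⟨fun H i => ?_, fun H i => ?_⟩
  · simpa [← add_assoc] using H (i + 1)
  · cases i with
    | zero => simp
    | succ i => simpa [← add_assoc] using H i

theorem down_cons_notMem_motzkinPathsFrom (w : List MotzkinStep) (n : ℕ) :
    MotzkinStep.D :: w ∉ motzkinPathsFrom (n + 1) 0 := by
  rintro ⟨-, h, -⟩
  have := h 1
  simp [MotzkinStep.rise] at this

theorem motzkinPathsFrom_succ_zero (n : ℕ) :
    motzkinPathsFrom (n + 1) 0 =
      (List.cons .U '' motzkinPathsFrom n 1) ∪ (List.cons .F '' motzkinPathsFrom n 0) := by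
  ext w
  rcases w with _ | ⟨s, w⟩
  · simp [motzkinPathsFrom]
  · cases s
    · rw [cons_mem_motzkinPathsFrom _ _ _ _ 1 (by simp [MotzkinStep.rise])]
      simp
    · rw [cons_mem_motzkinPathsFrom _ _ _ _ 0 (by simp [MotzkinStep.rise])]
      simp
    · simp [down_cons_notMem_motzkinPathsFrom]

theorem motzkinPathsFrom_succ_succ (n h : ℕ) :
    motzkinPathsFrom (n + 1) (h + 1) =
      (List.cons .U '' motzkinPathsFrom n (h + 2)) ∪ (List.cons .F '' motzkinPathsFrom n (h + 1)) ∪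
        (List.cons .D '' motzkinPathsFrom n h) := by
  ext w
  rcases w with _ | ⟨s, w⟩
  · simp [motzkinPathsFrom]
  · cases s
    · rw [cons_mem_motzkinPathsFrom _ _ _ _ (h + 2) (by simp [MotzkinStep.rise]; ring)]
      simp
    · rw [cons_mem_motzkinPathsFrom _ _ _ _ (h + 1) (by simp [MotzkinStep.rise])]
      simp
    · rw [cons_mem_motzkinPathsFrom _ _ _ _ h (by simp [MotzkinStep.rise])]
      simp

theorem disjoint_image_cons {α : Type*} {a b : α} (hab : a ≠ b) (s t : Set (List α)) :
    Disjoint (List.cons a '' s) (List.cons b '' t) := by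
  rw [Set.disjoint_left]
  rintro _ ⟨x, -, rfl⟩ ⟨y, -, h⟩
  exact hab (List.cons.inj h).1.symm

theorem ncard_motzkinPathsFrom (n h : ℕ) :
    (motzkinPathsFrom n h).Finite ∧ (motzkinPathsFrom n h).ncard = motzkinFrom n h := by
  induction n generalizing h with
  | zero =>
    cases h with
    | zero => simp [motzkinPathsFrom_zero_zero, motzkinFrom]
    | succ h => simp [motzkinPathsFrom_zero_succ, motzkinFrom]
  | succ n ih =>
    have hc : ∀ (s : MotzkinStep) (h : ℕ),
        (List.cons s '' motzkinPathsFrom n h).ncard = motzkinFrom n h := fun s h => by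
      rw [Set.ncard_image_of_injective _ List.cons_injective, (ih h).2]
    have hf : ∀ (s : MotzkinStep) (h : ℕ), (List.cons s '' motzkinPathsFrom n h).Finite :=
      fun s h => (ih h).1.image _
    cases h with
    | zero =>
      rw [motzkinPathsFrom_succ_zero]
      refine ⟨(hf _ _).union (hf _ _), ?_⟩
      rw [Set.ncard_union_eq (disjoint_image_cons (by simp) _ _) (hf _ _) (hf _ _), hc, hc,
        motzkinFrom]
    | succ h =>
      rw [motzkinPathsFrom_succ_succ]
      refine ⟨((hf _ _).union (hf _ _)).union (hf _ _), ?_⟩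
      rw [Set.ncard_union_eq _ ((hf _ _).union (hf _ _)) (hf _ _),
        Set.ncard_union_eq (disjoint_image_cons (by simp) _ _) (hf _ _) (hf _ _), hc, hc, hc,
        motzkinFrom]
      exact (disjoint_image_cons (by simp) _ _).union_left (disjoint_image_cons (by simp) _ _)

theorem motzkin_eq_motzkinFrom (n : ℕ) : motzkin n = motzkinFrom n 0 := by
  rw [← (ncard_motzkinPathsFrom n 0).2, motzkin]
  congr 1
  ext w
  simp [motzkinPathsFrom, IsMotzkinPath]

/-- The generating function of Motzkin words that start at height `h`. -/
noncomputable def motzkinFromGF (h : ℕ) : PowerSeries ℤ :=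
  PowerSeries.mk fun n => (motzkinFrom n h : ℤ)

theorem motzkinFromGF_zero :
    motzkinFromGF 0 = 1 + PowerSeries.X * (motzkinFromGF 1 + motzkinFromGF 0) := by
  ext n
  cases n with
  | zero => simp [motzkinFromGF, motzkinFrom]
  | succ n => simp [motzkinFromGF, motzkinFrom, PowerSeries.coeff_one, PowerSeries.coeff_succ_X_mul]

theorem motzkinFromGF_succ (h : ℕ) :
    motzkinFromGF (h + 1) =
      PowerSeries.X * (motzkinFromGF (h + 2) + motzkinFromGF (h + 1) + motzkinFromGF h) := by
  ext n
  cases n with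
  | zero => simp [motzkinFromGF, motzkinFrom]
  | succ n => simp [motzkinFromGF, motzkinFrom, PowerSeries.coeff_succ_X_mul]

/-- Each factor X expresses a coefficient through coefficients one degree lower, so the homogeneous
path recursion has only the zero solution. -/
theorem eq_zero_of_eq_X_mul {R : Type*} [CommRing R] (E : ℕ → PowerSeries R)
    (h0 : E 0 = PowerSeries.X * (E 1 + E 0))
    (hs : ∀ h, E (h + 1) = PowerSeries.X * (E (h + 2) + E (h + 1) + E h)) (h : ℕ) : E h = 0 := by
  ext n
  induction n generalizing h with
  | zero =>
    cases h with
    | zero => rw [h0]; simp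
    | succ h => rw [hs]; simp
  | succ n ih =>
    cases h with
    | zero => rw [h0, PowerSeries.coeff_succ_X_mul]; simp [ih]
    | succ h => rw [hs, PowerSeries.coeff_succ_X_mul]; simp [ih]

/-- First-passage decomposition at the first step from height h + 1 to h, obtained here by
uniqueness: the difference of the two sides satisfies the homogeneous recursion. -/
theorem motzkinFromGF_succ_eq (h : ℕ) :
    motzkinFromGF (h + 1) = PowerSeries.X * motzkinFromGF 0 * motzkinFromGF h := by
  have := eq_zero_of_eq_X_mul
    (fun h => motzkinFromGF (h + 1) - PowerSeries.X * motzkinFromGF 0 * motzkinFromGF h) ?_ ?_ h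
  · exact sub_eq_zero.1 this
  · have h1 := motzkinFromGF_succ 0
    have h2 := motzkinFromGF_zero
    simp only [zero_add] at h1 ⊢
    linear_combination h1 - PowerSeries.X * motzkinFromGF 0 * h2
  · intro h
    have h1 := motzkinFromGF_succ (h + 1)
    have h2 := motzkinFromGF_succ h
    linear_combination h1 - PowerSeries.X * motzkinFromGF 0 * h2

theorem motzkinGF_eq :
    motzkinGF = 1 + PowerSeries.X * motzkinGF + PowerSeries.X ^ 2 * motzkinGF ^ 2 := by
  have h : motzkinGF = motzkinFromGF 0 := by
    ext n
    simp [motzkinGF, motzkinFromGF, motzkin_eq_motzkinFrom]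
  rw [h]
  linear_combination motzkinFromGF_zero + PowerSeries.X * motzkinFromGF_succ_eq 0

/-! ### The power series `(c - 1) m(c - 1)` -/

theorem catalanGF_eq : catalanGF = 1 + PowerSeries.X * catalanGF ^ 2 := by
  have h := congrArg (PowerSeries.map (Nat.castRingHom ℤ)) PowerSeries.catalanSeries_sq_mul_X_add_one
  have h2 : PowerSeries.map (Nat.castRingHom ℤ) PowerSeries.catalanSeries = catalanGF := by
    ext n
    simp [catalanGF]
  simp only [map_add, map_mul, map_pow, map_one, PowerSeries.map_X, h2] at h
  linear_combination -h

/-- The power series `(c - 1) m(c - 1)`. -/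
noncomputable def treeGF : PowerSeries ℤ :=
  (catalanGF - 1) * PowerSeries.subst (catalanGF - 1) motzkinGF

theorem subst_motzkinGF_eq :
    PowerSeries.subst (catalanGF - 1) motzkinGF =
      1 + (catalanGF - 1) * PowerSeries.subst (catalanGF - 1) motzkinGF +
        (catalanGF - 1) ^ 2 * PowerSeries.subst (catalanGF - 1) motzkinGF ^ 2 := by
  have h := congrArg (PowerSeries.substAlgHom hasSubst_catalanGF_sub_one (R := ℤ)) motzkinGF_eq
  simp only [map_add, map_mul, map_pow, map_one, PowerSeries.substAlgHom_X] at h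
  rwa [PowerSeries.coe_substAlgHom] at h

/-- The Motzkin equation gives T = (c - 1)(1 + T + T²), that is cT = (c - 1)(1 + T)². Substitute c -
1 = xc² and cancel c. -/
theorem treeGF_eq : treeGF = PowerSeries.X * catalanGF * (1 + treeGF) ^ 2 := by
  have hc : catalanGF ≠ 0 := by
    intro h
    have := congrArg (PowerSeries.coeff 0) h
    simp [catalanGF] at this
  refine mul_left_cancel₀ hc ?_
  have h1 : treeGF = (catalanGF - 1) * (1 + treeGF + treeGF ^ 2) := by
    unfold treeGF
    linear_combination (catalanGF - 1) * subst_motzkinGF_eq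
  linear_combination h1 + (1 + treeGF) ^ 2 * catalanGF_eq

theorem constantCoeff_catalanGF_sub_one : PowerSeries.constantCoeff (catalanGF - 1) = 0 := by
  rw [← PowerSeries.coeff_zero_eq_constantCoeff_apply]
  simp [catalanGF]

theorem coeff_zero_treeGF : PowerSeries.coeff 0 treeGF = 0 := by
  simp [treeGF, constantCoeff_catalanGF_sub_one, -map_sub]

/-! ### Powers of c - 1 and sums over compositions -/

theorem mem_compositionsOfLength {n k : ℕ} {X : Composition n} :
    X ∈ compositionsOfLength n k ↔ X.blocks.length = k := by
  simp [compositionsOfLength, Composition.blocks_length]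

theorem List.ofFn_getD_of_length_eq {α : Type*} {l : List α} {k : ℕ} (h : l.length = k) (d : α) :
    List.ofFn (fun i : Fin k => l.getD i d) = l := by
  subst h
  refine List.ext_getElem (by simp) fun i h1 h2 => ?_
  simp

theorem catalan_pos (n : ℕ) : 0 < catalan n := by
  have h := succ_mul_catalan_eq_centralBinom n
  have := Nat.centralBinom_pos n
  by_contra h0
  rw [Nat.eq_zero_of_not_pos h0, mul_zero] at h
  omega

theorem coeff_catalanGF_sub_one_pow (n k : ℕ) :
    PowerSeries.coeff n ((catalanGF - 1) ^ k) =
      ((∑ X ∈ compositionsOfLength n k, (X.blocks.map catalan).prod : ℕ) : ℤ) := by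
  have hpow : (catalanGF - 1) ^ k = ∏ _i : Fin k, (catalanGF - 1) := by simp
  have hc : ∀ i, PowerSeries.coeff i (catalanGF - 1) = if i = 0 then 0 else (catalan i : ℤ) := by
    intro i
    rw [map_sub, PowerSeries.coeff_one, catalanGF, PowerSeries.coeff_mk]
    split_ifs with h <;> simp [h]
  rw [hpow, PowerSeries.coeff_prod, Nat.cast_sum]
  symm
  -- The product expansion also has tuples with zero parts. They contribute nothing because c - 1
  -- has no constant term, so only nonzero terms are matched.
  refine Finset.sum_bij_ne_zero
    (fun X _ _ => Finsupp.equivFunOnFinite.symm fun i : Fin k => X.blocks.getD i 0) ?_ ?_ ?_ ?_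
  · intro X hX _
    rw [mem_compositionsOfLength] at hX
    simp only [Finset.mem_finsuppAntidiag, Finset.subset_univ, and_true,
      Finsupp.equivFunOnFinite_symm_apply_apply]
    rw [← List.sum_ofFn, List.ofFn_getD_of_length_eq hX, X.blocks_sum]
  · intro X hX _ Y hY _ h
    rw [mem_compositionsOfLength] at hX hY
    apply Composition.ext
    rw [← List.ofFn_getD_of_length_eq hX, ← List.ofFn_getD_of_length_eq hY]
    exact congrArg List.ofFn (Finsupp.equivFunOnFinite.symm.injective h)
  · intro l hl hne
    simp only [Finset.mem_finsuppAntidiag, Finset.subset_univ, and_true] at hl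
    have hpos : ∀ i, 0 < l i := by
      intro i
      by_contra h
      refine hne (Finset.prod_eq_zero (Finset.mem_univ i) ?_)
      rw [hc, if_pos (by omega)]
    refine ⟨⟨List.ofFn l, ?_, by rw [List.sum_ofFn, hl]⟩, ?_, ?_, ?_⟩
    · intro i hi
      obtain ⟨j, rfl⟩ := (List.mem_ofFn' _ _).1 hi
      exact hpos j
    · rw [mem_compositionsOfLength]
      exact List.length_ofFn
    · rw [Nat.cast_ne_zero, Ne, List.prod_eq_zero_iff, List.mem_map]
      rintro ⟨i, -, hi⟩
      exact (catalan_pos i).ne' hi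
    · ext i
      simp
  · intro X hX _
    rw [mem_compositionsOfLength] at hX
    simp only [Finsupp.equivFunOnFinite_symm_apply_apply, hc]
    conv_lhs => rw [← List.ofFn_getD_of_length_eq hX 0]
    rw [List.map_ofFn, List.prod_ofFn, Nat.cast_prod]
    refine Finset.prod_congr rfl fun i _ => ?_
    have hi : (i : ℕ) < X.blocks.length := hX.symm ▸ i.2
    have : 0 < X.blocks.getD i 0 := by
      rw [List.getD_eq_getElem _ _ hi]
      exact X.blocks_pos (List.getElem_mem hi)
    rw [if_neg this.ne']
    rfl

theorem coeff_treeGF (n : ℕ) :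
    PowerSeries.coeff n treeGF =
      ((∑ k ∈ Finset.Icc 1 n, motzkin (k - 1) *
          ∑ X ∈ compositionsOfLength n k, (X.blocks.map catalan).prod : ℕ) : ℤ) := by
  have hT : treeGF = PowerSeries.subst (catalanGF - 1) (PowerSeries.X * motzkinGF) := by
    rw [PowerSeries.subst_mul hasSubst_catalanGF_sub_one,
      PowerSeries.subst_X hasSubst_catalanGF_sub_one, treeGF]
  rw [hT, PowerSeries.coeff_subst' hasSubst_catalanGF_sub_one,
    finsum_eq_sum_of_support_subset (s := Finset.Icc 1 n), Nat.cast_sum]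
  · refine Finset.sum_congr rfl fun k hk => ?_
    obtain ⟨j, rfl⟩ : ∃ j, k = j + 1 := ⟨k - 1, by have := Finset.mem_Icc.1 hk; omega⟩
    rw [coeff_catalanGF_sub_one_pow, PowerSeries.coeff_succ_X_mul, smul_eq_mul, Nat.cast_mul]
    simp [motzkinGF]
  · intro k hk
    rw [Function.mem_support] at hk
    rw [Finset.coe_Icc, Set.mem_Icc]
    constructor
    · by_contra h
      obtain rfl : k = 0 := by omega
      simp at hk
    · by_contra h
      refine hk ?_
      -- For k > n the power (c - 1)^k has order at least k, so the formally infinite sum stops at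
      -- n.
      rw [PowerSeries.coeff_of_lt_order n, smul_zero]
      refine lt_of_lt_of_le ?_ (PowerSeries.le_order_pow_of_constantCoeff_eq_zero k
        constantCoeff_catalanGF_sub_one)
      exact_mod_cast not_le.1 h

/-! ### Admissible pairs -/

/-- The permutation with value `v` at `0` whose remaining values are in the same relative order
as those of `σ`. -/
def insertFirst {n : ℕ} (v : Fin (n + 1)) (σ : Equiv.Perm (Fin n)) : Equiv.Perm (Fin (n + 1)) :=
  (finSuccEquiv' 0).trans ((Equiv.optionCongr σ).trans (finSuccEquiv' v).symm)

@[simp]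
theorem insertFirst_zero {n : ℕ} (v : Fin (n + 1)) (σ : Equiv.Perm (Fin n)) :
    insertFirst v σ 0 = v := by
  simp [insertFirst]

@[simp]
theorem insertFirst_succ {n : ℕ} (v : Fin (n + 1)) (σ : Equiv.Perm (Fin n)) (i : Fin n) :
    insertFirst v σ i.succ = v.succAbove (σ i) := by
  rw [insertFirst, Equiv.trans_apply, ← Fin.succAbove_zero_apply, finSuccEquiv'_succAbove]
  simp

theorem insertFirst_injective (n : ℕ) :
    Function.Injective fun x : Fin (n + 1) × Equiv.Perm (Fin n) => insertFirst x.1 x.2 := by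
  rintro ⟨v, σ⟩ ⟨w, τ⟩ h
  simp only at h
  obtain rfl : v = w := by simpa using DFunLike.congr_fun h 0
  refine Prod.ext rfl (Equiv.ext fun i => ?_)
  simpa using DFunLike.congr_fun h i.succ

theorem exists_insertFirst_eq {n : ℕ} (τ : Equiv.Perm (Fin (n + 1))) :
    ∃ v σ, insertFirst v σ = τ := by
  have h : Function.Bijective fun x : Fin (n + 1) × Equiv.Perm (Fin n) => insertFirst x.1 x.2 := by
    rw [Fintype.bijective_iff_injective_and_card]
    refine ⟨insertFirst_injective n, ?_⟩
    simp [Fintype.card_perm, Nat.factorial_succ]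
  obtain ⟨⟨v, σ⟩, hx⟩ := h.2 τ
  exact ⟨v, σ, hx⟩

/-- No positions `i < j < k` with `σ i < σ k < σ j`. -/
def Avoids132 {n : ℕ} (σ : Equiv.Perm (Fin n)) : Prop :=
  ∀ i j k, i < j → j < k → σ i < σ k → ¬ σ k < σ j

/-- No pair `p < q` with `σ p < σ q` is separated by the gap before position `s`. For a permutation
that avoids `132`, the values before position `s` are then larger than those from `s` on. -/
def IsCut {n : ℕ} (σ : Equiv.Perm (Fin n)) (s : ℕ) : Prop :=
  ∀ p q, p < q → σ p < σ q → ¬ ((p : ℕ) < s ∧ s ≤ q)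

/-- The pairs that encode the elements of `A n`: `σ` is the relative order of the values at the
middle elements of the cycles, and `f p` is the number of middle elements before the `p`-th
largest element of a cycle. -/
structure IsAdmissible {n : ℕ} (σ : Equiv.Perm (Fin n)) (f : Fin n → ℕ) : Prop where
  avoids : Avoids132 σ
  monotone : Monotone f
  lt : ∀ p : Fin n, (p : ℕ) < f p
  le : ∀ p, f p ≤ n
  eq : ∀ p q, p < q → σ p < σ q → f p = f q
  isCut : ∀ r, IsCut σ (f r)

/-- The first entry of a word, `0` for the empty word. -/
def headOrZero {n : ℕ} (g : Fin n → ℕ) : ℕ :=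
  if h : 0 < n then g ⟨0, h⟩ else 0

@[simp]
theorem headOrZero_succ {n : ℕ} (g : Fin (n + 1) → ℕ) : headOrZero g = g 0 := by
  simp [headOrZero]

/-! ### Effect of a prepended entry on avoidance, cuts and admissibility -/

theorem isCut_zero {n : ℕ} (σ : Equiv.Perm (Fin n)) : IsCut σ 0 := by
  intro p q _ _ h
  omega

theorem lt_insertFirst_succ {n : ℕ} (v : Fin (n + 1)) (σ : Equiv.Perm (Fin n)) (i : Fin n) :
    insertFirst v σ 0 < insertFirst v σ i.succ ↔ (v : ℕ) ≤ σ i := by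
  rw [insertFirst_zero, insertFirst_succ, Fin.lt_succAbove_iff_le_castSucc]
  rfl

theorem insertFirst_succ_lt_succ {n : ℕ} (v : Fin (n + 1)) (σ : Equiv.Perm (Fin n)) (i j : Fin n) :
    insertFirst v σ i.succ < insertFirst v σ j.succ ↔ σ i < σ j := by
  rw [insertFirst_succ, insertFirst_succ, Fin.succAbove_lt_succAbove_iff]

theorem avoids132_insertFirst {n : ℕ} (v : Fin (n + 1)) (σ : Equiv.Perm (Fin n)) :
    Avoids132 (insertFirst v σ) ↔ Avoids132 σ ∧ headOrZero (fun i => (σ i : ℕ)) ≤ v := by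
  constructor
  · intro h
    refine ⟨fun i j k hij hjk h1 h2 => h i.succ j.succ k.succ (Fin.succ_lt_succ_iff.2 hij)
      (Fin.succ_lt_succ_iff.2 hjk) ((insertFirst_succ_lt_succ _ _ _ _).2 h1)
      ((insertFirst_succ_lt_succ _ _ _ _).2 h2), ?_⟩
    cases n with
    | zero => simp [headOrZero]
    | succ n =>
      rw [headOrZero_succ]
      by_contra hlt
      rw [not_le] at hlt
      have hv : (v : ℕ) < n + 1 := by omega
      -- If v lies below the old head, then v, the old head and the entry that becomes v + 1 form a
      -- 132.
      let k := σ.symm ⟨v, hv⟩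
      have hk : ((σ k : Fin (n + 1)) : ℕ) = v := by simp [k]
      have hk0 : 0 < k := by
        rw [Fin.pos_iff_ne_zero]
        intro h0
        rw [h0] at hk
        omega
      exact h 0 (Fin.succ 0) k.succ (Fin.succ_pos _) (Fin.succ_lt_succ_iff.2 hk0)
        ((lt_insertFirst_succ _ _ _).2 hk.ge)
        ((insertFirst_succ_lt_succ _ _ _ _).2 (Fin.lt_def.2 (by omega)))
  · rintro ⟨h, h0⟩ i j k hij hjk h1 h2
    obtain ⟨j, rfl⟩ := Fin.exists_succ_eq.2 (Fin.pos_iff_ne_zero.1 (lt_of_le_of_lt (Fin.zero_le i) hij))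
    obtain ⟨k, rfl⟩ := Fin.exists_succ_eq.2 (Fin.pos_iff_ne_zero.1 (lt_trans (Fin.succ_pos j) hjk))
    rw [insertFirst_succ_lt_succ] at h2
    rw [Fin.succ_lt_succ_iff] at hjk
    rcases Fin.eq_zero_or_eq_succ i with rfl | ⟨i, rfl⟩
    · rw [lt_insertFirst_succ] at h1
      cases n with
      | zero => exact j.elim0
      | succ n =>
        rw [headOrZero_succ] at h0
        rcases Fin.eq_zero_or_eq_succ j with rfl | ⟨j, rfl⟩
        · rw [Fin.lt_def] at h2
          omega
        · refine h 0 j.succ k (Fin.succ_pos _) hjk (lt_of_le_of_ne (Fin.le_def.2 (h0.trans h1)) ?_) h2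
          intro he
          rw [← σ.injective he] at hjk
          simp at hjk
    · rw [insertFirst_succ_lt_succ] at h1
      exact h i j k (Fin.succ_lt_succ_iff.1 hij) hjk h1 h2

/-- The only new non-inversions pair the new head with the old entries of value at least v. -/
theorem isCut_insertFirst {n : ℕ} (v : Fin (n + 1)) (σ : Equiv.Perm (Fin n)) (s : ℕ) :
    IsCut (insertFirst v σ) (s + 1) ↔ IsCut σ s ∧ ∀ q, (v : ℕ) ≤ σ q → (q : ℕ) < s := by
  constructor
  · intro h
    refine ⟨fun p q hpq hσ hs => h p.succ q.succ (Fin.succ_lt_succ_iff.2 hpq)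
      ((insertFirst_succ_lt_succ _ _ _ _).2 hσ) (by simpa using hs), fun q hq => ?_⟩
    have := h 0 q.succ (Fin.succ_pos _) ((lt_insertFirst_succ _ _ _).2 hq)
    simpa using this
  · rintro ⟨h1, h2⟩ p q hpq hσ hs
    obtain ⟨q, rfl⟩ := Fin.exists_succ_eq.2 (Fin.pos_iff_ne_zero.1 (lt_of_le_of_lt (Fin.zero_le p) hpq))
    rcases Fin.eq_zero_or_eq_succ p with rfl | ⟨p, rfl⟩
    · have := h2 q ((lt_insertFirst_succ _ _ _).1 hσ)
      simp at hs
      omega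
    · exact h1 p q (Fin.succ_lt_succ_iff.1 hpq) ((insertFirst_succ_lt_succ _ _ _ _).1 hσ)
        (by simpa using hs)

theorem isCut_insertFirst_last {n : ℕ} (σ : Equiv.Perm (Fin n)) (s : ℕ) :
    IsCut (insertFirst (Fin.last n) σ) (s + 1) ↔ IsCut σ s := by
  rw [isCut_insertFirst, and_iff_left]
  intro q hq
  have := (σ q).2
  simp at hq
  omega

/-- An entry of value at least v is the head or forms a non-inversion with it, and f is constant
along non-inversions. -/
theorem headOrZero_eq_of_le {n : ℕ} {σ : Equiv.Perm (Fin n)} {f : Fin n → ℕ}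
    (h : ∀ p q, p < q → σ p < σ q → f p = f q) {v : ℕ}
    (hv : headOrZero (fun i => (σ i : ℕ)) ≤ v) {q : Fin n} (hq : v ≤ σ q) : headOrZero f = f q := by
  cases n with
  | zero => exact q.elim0
  | succ n =>
    rw [headOrZero_succ] at hv ⊢
    by_cases h0 : q = 0
    · rw [h0]
    · refine h 0 q (Fin.pos_iff_ne_zero.2 h0) (lt_of_le_of_ne (Fin.le_def.2 (hv.trans hq)) ?_)
      exact fun he => h0 (σ.injective he.symm)

theorem lt_of_isCut_of_headOrZero_le {n : ℕ} {σ : Equiv.Perm (Fin n)} {s : ℕ}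
    (h : IsCut σ s) (hs : 0 < s) {v : ℕ}
    (hv : headOrZero (fun i => (σ i : ℕ)) ≤ v) {q : Fin n} (hq : v ≤ σ q) : (q : ℕ) < s := by
  cases n with
  | zero => exact q.elim0
  | succ n =>
    rw [headOrZero_succ] at hv
    by_cases h0 : q = 0
    · rw [h0]
      simpa using hs
    · have := h 0 q (Fin.pos_iff_ne_zero.2 h0) (lt_of_le_of_ne (Fin.le_def.2 (hv.trans hq)) ?_)
      · simp at this
        omega
      · exact fun he => h0 (σ.injective he.symm)

/-- Some old entry exceeds the new head, which destroys the cut just after that head. Every other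
cut survives, since all such entries lie on the head's side of it. -/
theorem isCut_insertFirst_of_lt {n : ℕ} {v : Fin (n + 1)} (hv : (v : ℕ) < n)
    {σ : Equiv.Perm (Fin n)} (h0 : headOrZero (fun i => (σ i : ℕ)) ≤ v) (s : ℕ) :
    IsCut (insertFirst v σ) (s + 1) ↔ IsCut σ s ∧ s ≠ 0 := by
  rw [isCut_insertFirst]
  refine and_congr_right fun h => ⟨fun H hs => ?_, fun hs q hq =>
    lt_of_isCut_of_headOrZero_le h (Nat.pos_of_ne_zero hs) h0 hq⟩
  have := H (σ.symm ⟨v, hv⟩) (by simp)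
  omega

theorem monotone_cons {n : ℕ} (a : ℕ) (f : Fin n → ℕ) :
    Monotone (Fin.cons a (fun i => f i + 1) : Fin (n + 1) → ℕ) ↔
      Monotone f ∧ (0 < n → a ≤ headOrZero f + 1) := by
  constructor
  · intro h
    refine ⟨fun i j hij => ?_, fun hn => ?_⟩
    · simpa using h (Fin.succ_le_succ_iff.2 hij)
    · obtain ⟨m, rfl⟩ : ∃ m, n = m + 1 := ⟨n - 1, by omega⟩
      simpa using h (Fin.zero_le (Fin.succ 0))
  · rintro ⟨h1, h2⟩ i j hij
    rcases Fin.eq_zero_or_eq_succ j with rfl | ⟨j, rfl⟩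
    · rw [Fin.le_zero_iff.1 hij]
    · rcases Fin.eq_zero_or_eq_succ i with rfl | ⟨i, rfl⟩
      · obtain ⟨m, rfl⟩ : ∃ m, n = m + 1 := ⟨n - 1, by have := j.2; omega⟩
        simp only [Fin.cons_zero, Fin.cons_succ]
        have := h1 (Fin.zero_le j)
        have := h2 (Nat.succ_pos _)
        rw [headOrZero_succ] at this
        omega
      · simpa using h1 (Fin.succ_le_succ_iff.1 hij)

theorem headOrZero_le {n : ℕ} {f : Fin n → ℕ} (h : ∀ p, f p ≤ n) : headOrZero f ≤ n := by
  unfold headOrZero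
  split_ifs
  · exact h _
  · omega

/-- A new middle element precedes all maxima already present, hence the shift f + 1. If v < n, the
new head forms a non-inversion with an old entry, which forces a. If v = n it forms none, and a - 1
may be any cut of σ up to the first entry of f. -/
theorem isAdmissible_insertFirst {n : ℕ} (v : Fin (n + 1)) (σ : Equiv.Perm (Fin n)) (a : ℕ)
    (f : Fin n → ℕ) :
    IsAdmissible (insertFirst v σ) (Fin.cons a (fun i => f i + 1) : Fin (n + 1) → ℕ) ↔
      IsAdmissible σ f ∧ headOrZero (fun i => (σ i : ℕ)) ≤ v ∧
        (((v : ℕ) < n ∧ a = headOrZero f + 1) ∨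
          ((v : ℕ) = n ∧ 1 ≤ a ∧ a ≤ headOrZero f + 1 ∧ IsCut σ (a - 1))) := by
  constructor
  · intro h
    have hav := (avoids132_insertFirst v σ).1 h.avoids
    have hmon := (monotone_cons a f).1 h.monotone
    have hcut : ∀ r, IsCut σ (f r) := fun r => by
      have := h.isCut r.succ
      rw [Fin.cons_succ, isCut_insertFirst] at this
      exact this.1
    have hle : ∀ p, f p ≤ n := fun p => by simpa using h.le p.succ
    have ha := h.lt 0
    have ha' := h.le 0
    have hc := h.isCut 0
    simp only [Fin.cons_zero] at ha ha' hc
    obtain ⟨a, rfl⟩ : ∃ b, a = b + 1 := ⟨a - 1, by omega⟩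
    rw [isCut_insertFirst] at hc
    have heq : ∀ p q, p < q → σ p < σ q → f p = f q := fun p q hpq hσ => by
      simpa using h.eq p.succ q.succ (Fin.succ_lt_succ_iff.2 hpq)
        ((insertFirst_succ_lt_succ _ _ _ _).2 hσ)
    refine ⟨⟨hav.1, hmon.1, fun p => by simpa using h.lt p.succ, hle, heq, hcut⟩, hav.2, ?_⟩
    rcases (Nat.lt_succ_iff.1 v.2).lt_or_eq with hv | hv
    · refine Or.inl ⟨hv, ?_⟩
      have hq : (v : ℕ) ≤ σ (σ.symm ⟨v, hv⟩) := by simp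
      have := h.eq 0 (Fin.succ (σ.symm ⟨v, hv⟩)) (Fin.succ_pos _) ((lt_insertFirst_succ _ _ _).2 hq)
      rw [Fin.cons_zero, Fin.cons_succ] at this
      rw [this, headOrZero_eq_of_le heq hav.2 hq]
    · refine Or.inr ⟨hv, ha, ?_, by simpa using hc.1⟩
      rcases Nat.eq_zero_or_pos n with h0 | h0
      · omega
      · exact hmon.2 h0
  · rintro ⟨h, h0, hv⟩
    have hn := headOrZero_le h.le
    have ha : 1 ≤ a ∧ a ≤ headOrZero f + 1 := by omega
    obtain ⟨a, rfl⟩ : ∃ b, a = b + 1 := ⟨a - 1, by omega⟩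
    refine ⟨(avoids132_insertFirst v σ).2 ⟨h.avoids, h0⟩, (monotone_cons _ f).2
      ⟨h.monotone, fun _ => ha.2⟩, ?_, ?_, ?_, ?_⟩
    · refine Fin.cases ?_ ?_
      · simp
      · simpa using h.lt
    · refine Fin.cases ?_ ?_
      · simp
        omega
      · simpa using h.le
    · intro p q hpq hσ
      obtain ⟨q, rfl⟩ := Fin.exists_succ_eq.2 (Fin.pos_iff_ne_zero.1 (lt_of_le_of_lt (Fin.zero_le p) hpq))
      rcases Fin.eq_zero_or_eq_succ p with rfl | ⟨p, rfl⟩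
      · rw [lt_insertFirst_succ] at hσ
        have := (σ q).2
        have := headOrZero_eq_of_le h.eq h0 hσ
        simp
        omega
      · simpa using h.eq p q (Fin.succ_lt_succ_iff.1 hpq) ((insertFirst_succ_lt_succ _ _ _ _).1 hσ)
    · have hpos : ∀ r, IsCut (insertFirst v σ) (f r + 1) := by
        intro r
        rw [isCut_insertFirst]
        exact ⟨h.isCut r, fun q hq => lt_of_isCut_of_headOrZero_le (h.isCut r)
          (lt_of_le_of_lt (Nat.zero_le _) (h.lt r)) h0 hq⟩
      refine Fin.cases ?_ ?_
      · rw [Fin.cons_zero]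
        rcases hv with ⟨hv, ha⟩ | ⟨hv, -, -, hc⟩
        · obtain ⟨m, rfl⟩ : ∃ m, n = m + 1 := ⟨n - 1, by omega⟩
          rw [ha, headOrZero_succ]
          exact hpos 0
        · obtain rfl : v = Fin.last n := Fin.ext hv
          exact (isCut_insertFirst_last σ a).2 (by simpa using hc)
      · simpa using hpos

/-! ### The generating tree of admissible pairs and its labels -/

theorem IsAdmissible.exists_eq_cons {n : ℕ} {τ : Equiv.Perm (Fin (n + 1))} {g : Fin (n + 1) → ℕ}
    (h : IsAdmissible τ g) :
    ∃ (a : ℕ) (f : Fin n → ℕ), g = (Fin.cons a (fun i => f i + 1) : Fin (n + 1) → ℕ) := by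
  refine ⟨g 0, fun i => g i.succ - 1, funext (Fin.cases rfl fun i => ?_)⟩
  have := h.lt i.succ
  simp only [Fin.cons_succ]
  omega

/-- The number of elements of V up to t is the rank of t in V, so it takes each value from 1 to |V|
once. -/
theorem Finset.sum_card_filter_le {M : Type*} [AddCommMonoid M] (V : Finset ℕ) (h : ℕ → M) :
    ∑ t ∈ V, h (V.filter (· ≤ t)).card = ∑ i ∈ Finset.Icc 1 V.card, h i := by
  induction V using Finset.induction_on_max with
  | empty => simp
  | insert a V ha ih =>
    have hna : a ∉ V := fun h => lt_irrefl _ (ha a h)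
    rw [Finset.sum_insert hna, Finset.card_insert_of_notMem hna,
      Finset.sum_Icc_succ_top (by omega), ← ih, add_comm]
    congr 1
    · refine Finset.sum_congr rfl fun t ht => ?_
      rw [Finset.filter_insert, if_neg (not_le.2 (ha t ht))]
    · rw [Finset.filter_true_of_mem, Finset.card_insert_of_notMem hna]
      intro x hx
      rcases Finset.mem_insert.1 hx with rfl | hx
      · exact le_rfl
      · exact (ha x hx).le

open Classical in
/-- The finite set of admissible pairs. -/
noncomputable def admissiblePairs (n : ℕ) : Finset (Equiv.Perm (Fin n) × (Fin n → ℕ)) :=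
  (Finset.univ ×ˢ Fintype.piFinset fun _ => Finset.range (n + 1)).filter fun x =>
    IsAdmissible x.1 x.2

theorem mem_admissiblePairs {n : ℕ} {x : Equiv.Perm (Fin n) × (Fin n → ℕ)} :
    x ∈ admissiblePairs n ↔ IsAdmissible x.1 x.2 := by
  simp only [admissiblePairs, Finset.mem_filter, Finset.mem_product, Finset.mem_univ, true_and,
    Fintype.mem_piFinset, Finset.mem_range, and_iff_right_iff_imp]
  exact fun h i => Nat.lt_succ_of_le (h.le i)

/-- The number of values from the first one on. -/
def coheight {n : ℕ} (σ : Equiv.Perm (Fin n)) : ℕ :=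
  n - headOrZero fun i => (σ i : ℕ)

open Classical in
/-- The number of cuts of `σ` up to the first entry of `f`. -/
noncomputable def cutRank {n : ℕ} (σ : Equiv.Perm (Fin n)) (f : Fin n → ℕ) : ℕ :=
  ((Finset.range (headOrZero f + 1)).filter (IsCut σ)).card

theorem coheight_insertFirst {n : ℕ} (v : Fin (n + 1)) (σ : Equiv.Perm (Fin n)) :
    coheight (insertFirst v σ) = n + 1 - v := by
  simp [coheight]

open Classical in
theorem card_filter_range_succ (p : ℕ → Prop) (n : ℕ) :
    ((Finset.range (n + 1)).filter p).card =
      ((Finset.range n).filter fun i => p (i + 1)).card + if p 0 then 1 else 0 := by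
  simp only [Finset.card_filter]
  rw [Finset.sum_range_succ']

open Classical in
theorem cutRank_insertFirst {n : ℕ} (v : Fin (n + 1)) (σ : Equiv.Perm (Fin n)) (a : ℕ)
    (f : Fin n → ℕ) :
    cutRank (insertFirst v σ) (Fin.cons a f : Fin (n + 1) → ℕ) =
      ((Finset.range a).filter fun s => IsCut (insertFirst v σ) (s + 1)).card + 1 := by
  rw [cutRank, card_filter_range_succ, if_pos (isCut_zero _), headOrZero_succ, Fin.cons_zero]

/-- The nonzero cuts shift by one. The cut 0 does not survive the shift, but the new cut 0 replaces
it. -/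
theorem cutRank_insertFirst_of_lt {n : ℕ} {v : Fin (n + 1)} (hv : (v : ℕ) < n)
    {σ : Equiv.Perm (Fin n)} (h0 : headOrZero (fun i => (σ i : ℕ)) ≤ v) (f g : Fin n → ℕ) :
    cutRank (insertFirst v σ) (Fin.cons (headOrZero f + 1) g : Fin (n + 1) → ℕ) = cutRank σ f := by
  classical
  rw [cutRank_insertFirst, cutRank, card_filter_range_succ, card_filter_range_succ,
    if_pos (isCut_zero _), if_neg]
  · simp [isCut_insertFirst_of_lt hv h0]
  · simp [isCut_insertFirst_of_lt hv h0]

open Classical in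
theorem cutRank_insertFirst_last {n : ℕ} (σ : Equiv.Perm (Fin n)) (t : ℕ) (g : Fin n → ℕ) :
    cutRank (insertFirst (Fin.last n) σ) (Fin.cons (t + 1) g : Fin (n + 1) → ℕ) =
      ((Finset.range (t + 1)).filter (IsCut σ)).card + 1 := by
  rw [cutRank_insertFirst]
  simp [isCut_insertFirst_last]

open Classical in
/-- The first entries that extend an admissible pair. -/
noncomputable def extensions {n : ℕ} (σ : Equiv.Perm (Fin n)) (f : Fin n → ℕ) :
    Finset (Fin (n + 1) × ℕ) :=
  (Finset.univ ×ˢ Finset.range (n + 2)).filter fun y =>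
    headOrZero (fun i => (σ i : ℕ)) ≤ y.1 ∧
      (((y.1 : ℕ) < n ∧ y.2 = headOrZero f + 1) ∨
        ((y.1 : ℕ) = n ∧ 1 ≤ y.2 ∧ y.2 ≤ headOrZero f + 1 ∧ IsCut σ (y.2 - 1)))

theorem mem_extensions {n : ℕ} {σ : Equiv.Perm (Fin n)} {f : Fin n → ℕ} (h : IsAdmissible σ f)
    {v : Fin (n + 1)} {a : ℕ} :
    (v, a) ∈ extensions σ f ↔
      IsAdmissible (insertFirst v σ) (Fin.cons a (fun i => f i + 1) : Fin (n + 1) → ℕ) := by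
  classical
  rw [isAdmissible_insertFirst, extensions, Finset.mem_filter, and_iff_right h,
    and_iff_right_iff_imp]
  have := headOrZero_le h.le
  simp
  omega

theorem sum_admissiblePairs_succ {M : Type*} [AddCommMonoid M] {n : ℕ}
    (F : Equiv.Perm (Fin (n + 1)) × (Fin (n + 1) → ℕ) → M) :
    ∑ x ∈ admissiblePairs (n + 1), F x =
      ∑ x ∈ admissiblePairs n, ∑ y ∈ extensions x.1 x.2,
        F (insertFirst y.1 x.1, (Fin.cons y.2 (fun i => x.2 i + 1) : Fin (n + 1) → ℕ)) := by
  rw [Finset.sum_sigma']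
  symm
  refine Finset.sum_bij (fun z _ => (insertFirst z.2.1 z.1.1,
    (Fin.cons z.2.2 (fun i => z.1.2 i + 1) : Fin (n + 1) → ℕ))) ?_ ?_ ?_ (fun _ _ => rfl)
  · rintro ⟨⟨σ, f⟩, v, a⟩ h
    rw [Finset.mem_sigma, mem_admissiblePairs] at h
    exact mem_admissiblePairs.2 ((mem_extensions h.1).1 h.2)
  · rintro ⟨⟨σ, f⟩, v, a⟩ - ⟨⟨τ, g⟩, w, b⟩ - h
    obtain ⟨h1, h2⟩ := Prod.ext_iff.1 h
    obtain ⟨rfl, rfl⟩ : v = w ∧ σ = τ :=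
      Prod.ext_iff.1 (insertFirst_injective n (a₁ := (v, σ)) (a₂ := (w, τ)) h1)
    obtain ⟨rfl, h3⟩ : a = b ∧ (fun i => f i + 1) = fun i => g i + 1 :=
      Fin.cons_injective2 (α := fun _ => ℕ) h2
    obtain rfl : f = g := funext fun i => by simpa using congrFun h3 i
    rfl
  · rintro ⟨τ, g⟩ h
    rw [mem_admissiblePairs] at h
    obtain ⟨v, σ, rfl⟩ := exists_insertFirst_eq τ
    obtain ⟨a, f, rfl⟩ := h.exists_eq_cons
    have h' := ((isAdmissible_insertFirst _ _ _ _).1 h).1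
    refine ⟨⟨⟨σ, f⟩, v, a⟩, ?_, rfl⟩
    rw [Finset.mem_sigma, mem_admissiblePairs]
    exact ⟨h', (mem_extensions h').2 h⟩

/-- A head v < n keeps the cut rank and has coheight n + 1 - v, giving the first sum. The head v = n
has coheight 1, and choosing the i-th cut for a - 1 gives cut rank i + 1, the extra cut being 0. -/
theorem sum_extensions {n : ℕ} {σ : Equiv.Perm (Fin n)} {f : Fin n → ℕ}
    (hx : IsAdmissible σ f) (h : ℕ → ℕ → ℤ) :
    ∑ y ∈ extensions σ f, h (coheight (insertFirst y.1 σ))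
        (cutRank (insertFirst y.1 σ) (Fin.cons y.2 (fun i => f i + 1) : Fin (n + 1) → ℕ)) =
      ∑ i ∈ Finset.Icc 2 (coheight σ + 1), h i (cutRank σ f) +
        ∑ i ∈ Finset.Icc 1 (cutRank σ f), h 1 (i + 1) := by
  classical
  have hn : headOrZero f ≤ n := headOrZero_le hx.le
  have hσ : headOrZero (fun i => (σ i : ℕ)) ≤ n := headOrZero_le fun p => (σ p).2.le
  rw [extensions, Finset.sum_filter, Finset.sum_product, Fin.sum_univ_castSucc]
  congr 1
  · have h1 : ∀ v : Fin n, (∑ a ∈ Finset.range (n + 2),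
        if headOrZero (fun i => (σ i : ℕ)) ≤ (v.castSucc : Fin (n + 1)) ∧
          ((((v.castSucc : Fin (n + 1)) : ℕ) < n ∧ a = headOrZero f + 1) ∨
            (((v.castSucc : Fin (n + 1)) : ℕ) = n ∧ 1 ≤ a ∧ a ≤ headOrZero f + 1 ∧
              IsCut σ (a - 1))) then
          h (coheight (insertFirst v.castSucc σ)) (cutRank (insertFirst v.castSucc σ)
            (Fin.cons a (fun i => f i + 1) : Fin (n + 1) → ℕ)) else 0) =
        if headOrZero (fun i => (σ i : ℕ)) ≤ v then h (n + 1 - v) (cutRank σ f) else 0 := by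
      intro v
      have hv : ((v.castSucc : Fin (n + 1)) : ℕ) < n := v.2
      rw [Finset.sum_eq_single (headOrZero f + 1)]
      · simp only [hv, true_or, and_true]
        refine ite_congr rfl (fun h0 => ?_) fun _ => rfl
        rw [coheight_insertFirst, cutRank_insertFirst_of_lt hv h0]
        rfl
      · intro a _ ha
        rw [if_neg]
        omega
      · intro hm
        simp at hm
        omega
    rw [Finset.sum_congr rfl fun v _ => h1 v, Fin.sum_univ_eq_sum_range
      (fun v => if headOrZero (fun i => (σ i : ℕ)) ≤ v then h (n + 1 - v) (cutRank σ f) else 0),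
      ← Finset.sum_filter]
    refine Finset.sum_bij' (fun v _ => n + 1 - v) (fun u _ => n + 1 - u) ?_ ?_ ?_ ?_ ?_ <;>
    · simp only [Finset.mem_filter, Finset.mem_range, Finset.mem_Icc, coheight]
      intro v hv
      first | omega | trivial
  · rw [← Finset.sum_filter]
    rw [cutRank, ← Finset.sum_card_filter_le _ fun i => h 1 (i + 1)]
    symm
    refine Finset.sum_bij (fun t _ => t + 1) ?_ ?_ ?_ ?_
    · intro t ht
      rw [Finset.mem_filter, Finset.mem_range] at ht
      rw [Finset.mem_filter, Finset.mem_range]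
      exact ⟨by omega, hσ, Or.inr ⟨rfl, by omega, by omega, ht.2⟩⟩
    · simp
    · intro a ha
      rw [Finset.mem_filter, Finset.mem_range] at ha
      obtain ⟨h1, -, ⟨h2, -⟩ | ⟨-, h2, h3, h4⟩⟩ := ha
      · simp at h2
      · exact ⟨a - 1, Finset.mem_filter.2 ⟨Finset.mem_range.2 (by omega), h4⟩, by omega⟩
    · intro t ht
      rw [Finset.mem_filter, Finset.mem_range] at ht
      rw [coheight_insertFirst, cutRank_insertFirst_last, Fin.val_last, Nat.add_sub_cancel_left]
      congr 3
      ext s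
      simp only [Finset.mem_filter, Finset.mem_range]
      grind

/-! ### Generating functions attached to the labels -/

theorem mul_sum_pow_add_two {R : Type*} [CommRing R] {a q : R} (h : q = 1 + a * q ^ 2) (m : ℕ) :
    a * ∑ i ∈ Finset.range m, q ^ (i + 2) = q ^ m - 1 := by
  induction m with
  | zero => simp
  | succ m ih =>
    rw [Finset.sum_range_succ, mul_add, ih]
    -- The sum telescopes, since a q^(m+2) = q^(m+1) - q^m.
    linear_combination -q ^ m * h

theorem Finset.sum_Icc_eq_sum_range_add {M : Type*} [AddCommMonoid M] (h : ℕ → M) (a m b : ℕ)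
    (hb : b + 1 = m + a) : ∑ i ∈ Finset.Icc a b, h i = ∑ i ∈ Finset.range m, h (i + a) := by
  rw [Finset.range_eq_Ico, Finset.sum_Ico_add' h, zero_add, ← hb]
  rfl

/-- Both child sums telescope: the first with q = c and a = x, the second with q = 1 + T and a = xc.
-/
theorem catalanGF_pow_mul_eq (u r : ℕ) :
    catalanGF ^ u * (1 + treeGF) ^ r =
      1 + PowerSeries.X *
        (∑ i ∈ Finset.Icc 2 (u + 1), catalanGF ^ i * (1 + treeGF) ^ r +
          ∑ i ∈ Finset.Icc 1 r, catalanGF ^ 1 * (1 + treeGF) ^ (i + 1)) := by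
  have h1 := mul_sum_pow_add_two catalanGF_eq u
  have h2 := mul_sum_pow_add_two (a := PowerSeries.X * catalanGF) (q := 1 + treeGF)
    (by linear_combination treeGF_eq) r
  rw [Finset.sum_Icc_eq_sum_range_add _ 2 u _ rfl, Finset.sum_Icc_eq_sum_range_add _ 1 r _ rfl,
    ← Finset.sum_mul, ← Finset.mul_sum]
  simp only [add_assoc, Nat.reduceAdd] at h1 h2 ⊢
  linear_combination -(1 + treeGF) ^ r * h1 - h2

theorem admissiblePairs_zero : admissiblePairs 0 = {(1, Fin.elim0)} := by
  ext x
  rw [mem_admissiblePairs, Finset.mem_singleton]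
  refine ⟨fun _ => Subsingleton.elim _ _, fun _ => ⟨?_, ?_, ?_, ?_, ?_, ?_⟩⟩ <;>
  exact fun p => p.elim0

/-- The left side counts descendants m levels below level n. The shift m stays free in the
induction, because passing to children trades one power of x for one level. -/
theorem sum_coeff_admissiblePairs (n m : ℕ) :
    ∑ x ∈ admissiblePairs n,
        PowerSeries.coeff m (catalanGF ^ coheight x.1 * (1 + treeGF) ^ cutRank x.1 x.2) =
      PowerSeries.coeff (m + n) (1 + treeGF) := by
  induction n generalizing m with
  | zero =>
    rw [admissiblePairs_zero, Finset.sum_singleton]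
    have h1 : coheight (1 : Equiv.Perm (Fin 0)) = 0 := by simp [coheight]
    have h2 : cutRank (1 : Equiv.Perm (Fin 0)) Fin.elim0 = 1 := by
      simp [cutRank, headOrZero, Finset.filter_singleton, isCut_zero]
    rw [h1, h2, pow_zero, pow_one, one_mul, add_zero]
  | succ n ih =>
    rw [sum_admissiblePairs_succ, ← add_assoc, add_right_comm, ← ih]
    refine Finset.sum_congr rfl fun x hx => ?_
    rw [sum_extensions (mem_admissiblePairs.1 hx) fun u r =>
      PowerSeries.coeff m (catalanGF ^ u * (1 + treeGF) ^ r), catalanGF_pow_mul_eq, map_add,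
      PowerSeries.coeff_succ_X_mul, PowerSeries.coeff_one, if_neg (Nat.succ_ne_zero m), zero_add,
      map_add, map_sum, map_sum]

theorem card_admissiblePairs (n : ℕ) :
    ((admissiblePairs n).card : ℤ) = PowerSeries.coeff n (1 + treeGF) := by
  -- At m = 0 every summand is 1, since c and 1 + T have constant term 1.
  rw [← zero_add n, ← sum_coeff_admissiblePairs, Finset.cast_card, zero_add]
  refine Finset.sum_congr rfl fun x _ => ?_
  have h1 : PowerSeries.constantCoeff catalanGF = 1 := by
    have := constantCoeff_catalanGF_sub_one
    rwa [map_sub, map_one, sub_eq_zero] at this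
  have h2 : PowerSeries.constantCoeff treeGF = 0 := by
    rw [← PowerSeries.coeff_zero_eq_constantCoeff_apply, coeff_zero_treeGF]
  simp [h1, h2]

/-! ### Permutations all of whose cycles are 3-cycles of the form 312 -/

theorem exists_orderEmbedding_fin_three {N : ℕ} {a b c : Fin N} (hab : a < b) (hbc : b < c) :
    ∃ f : Fin 3 ↪o Fin N, f 0 = a ∧ f 1 = b ∧ f 2 = c := by
  have h : StrictMono ![a, b, c] := by
    rw [Fin.strictMono_iff_lt_succ]
    intro i
    fin_cases i
    · exact hab
    · exact hbc
  exact ⟨OrderEmbedding.ofStrictMono _ h, rfl, rfl, rfl⟩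

theorem avoidsPattern_one_three_two {N : ℕ} (π : Equiv.Perm (Fin N)) :
    AvoidsPattern π ![1, 3, 2] ↔ Avoids132 π := by
  constructor
  · intro h i j k hij hjk h1 h2
    obtain ⟨f, rfl, rfl, rfl⟩ := exists_orderEmbedding_fin_three hij hjk
    refine h f fun s t => ?_
    fin_cases s <;> fin_cases t <;> simp <;> omega
  · intro h f hf
    have h1 := (hf 0 2).2 (by simp)
    have h2 := (hf 2 1).2 (by simp)
    exact h (f 0) (f 1) (f 2) (by simp) (by simp) h1 h2

/-- All cycles of `π` are 3-cycles `a ↦ c ↦ b ↦ a` with `a < b < c`. -/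
structure AllCycles312 {N : ℕ} (π : Equiv.Perm (Fin N)) : Prop where
  cube : ∀ x, π (π (π x)) = x
  ne : ∀ x, π x ≠ x
  form : ∀ x, x < π x → ¬ π x < π (π x)

theorem support_cycleOf_of_cube {N : ℕ} {π : Equiv.Perm (Fin N)} (h : ∀ x, π (π (π x)) = x)
    (hne : ∀ x, π x ≠ x) (x : Fin N) : (π.cycleOf x).support = {x, π x, π (π x)} := by
  ext y
  rw [Equiv.Perm.mem_support_cycleOf_iff' (hne x)]
  simp only [Finset.mem_insert, Finset.mem_singleton]
  constructor
  · intro hs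
    obtain ⟨k, rfl⟩ := hs.exists_nat_pow_eq
    induction k with
    | zero => simp
    | succ k ih =>
      rw [pow_succ', Equiv.Perm.mul_apply]
      rcases ih ⟨k, rfl⟩ with h' | h' | h' <;> rw [h'] <;> simp [h]
  · rintro (rfl | rfl | rfl)
    · rfl
    · exact ⟨1, by simp⟩
    · exact ⟨2, by simp [sq]⟩

theorem allCycles312_of_mem_A {n : ℕ} {π : Equiv.Perm (Fin (3 * n))} (h : π ∈ A n) :
    AllCycles312 π := by
  obtain ⟨h1, -, h3⟩ := h
  have h1 : π.cycleType = Multiset.replicate n 3 := h1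
  have hcube : ∀ x, π (π (π x)) = x := by
    have : π ^ 3 = 1 := by
      rw [← orderOf_dvd_iff_pow_eq_one, ← Equiv.Perm.lcm_cycleType, Multiset.lcm_dvd, h1]
      intro b hb
      rw [Multiset.eq_of_mem_replicate hb]
    intro x
    have := DFunLike.congr_fun this x
    simpa [pow_succ] using this
  have hne : ∀ x, π x ≠ x := by
    have hc : π.support = Finset.univ := by
      rw [← Finset.card_eq_iff_eq_univ, ← Equiv.Perm.sum_cycleType, h1]
      simp [mul_comm]
    intro x
    rw [← Equiv.Perm.mem_support, hc]
    exact Finset.mem_univ x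
  refine ⟨hcube, hne, fun x hx1 hx2 => ?_⟩
  obtain ⟨f, hf, ho⟩ := h3 (π.cycleOf x)
    (Equiv.Perm.cycleOf_mem_cycleFactorsFinset_iff.2 (Equiv.Perm.mem_support.2 (hne x)))
  rw [support_cycleOf_of_cube hcube hne] at hf
  have h01 : f 0 < f 1 := by simp
  have h12 : f 1 < f 2 := by simp
  have ho1 := (ho 1 2).2 (by simp)
  have ho2 := (ho 2 0).2 (by simp)
  have hmem : ∀ i, f i = x ∨ f i = π x ∨ f i = π (π x) := by
    intro i
    have : f i ∈ Set.range f := ⟨i, rfl⟩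
    rw [hf] at this
    simpa using this
  -- If x < π x < π (π x), these are the positions read by f. The pattern 312 then demands π (π x) <
  -- x, a contradiction.
  have e0 : f 0 = x := by
    have := hmem 0
    have := hmem 1
    have := hmem 2
    omega
  have e1 : f 1 = π x := by
    have := hmem 1
    have := hmem 2
    omega
  have e2 : f 2 = π (π x) := by
    have := hmem 2
    omega
  rw [e1, e2, hcube] at ho1
  rw [e2, e0, hcube] at ho2
  omega

/-- The three alternatives say that x is the minimum, the maximum or the middle element of its
cycle. -/
theorem AllCycles312.exists_lt_lt {N : ℕ} {π : Equiv.Perm (Fin N)} (h : AllCycles312 π)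
    (x : Fin N) :
    (x < π (π x) ∧ π (π x) < π x) ∨ (π (π x) < π x ∧ π x < x) ∨ (π x < x ∧ x < π (π x)) := by
  have h1 := h.form x
  have h2 := h.form (π x)
  have h3 := h.form (π (π x))
  have h4 := h.ne x
  have h5 := h.ne (π x)
  have h6 := h.ne (π (π x))
  simp only [h.cube] at *
  omega

theorem AllCycles312.mem_A {n : ℕ} {π : Equiv.Perm (Fin (3 * n))} (h : AllCycles312 π)
    (hav : Avoids132 π) : π ∈ A n := by
  refine ⟨?_, (avoidsPattern_one_three_two π).2 hav, fun c hc => ?_⟩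
  · have hp : π ^ 3 = 1 := by
      ext x
      simp [pow_succ, h.cube]
    have : Fact (Nat.Prime 3) := ⟨Nat.prime_three⟩
    have hr := Equiv.Perm.cycleType_of_pow_prime_eq_one hp
    have hs : π.support = Finset.univ := by
      ext x
      simp [h.ne x]
    have hc := π.sum_cycleType
    rw [hs, hr] at hc
    simp at hc
    have hn : Multiset.card π.cycleType = n := by omega
    rw [hn] at hr
    exact hr
  · have key : ∀ x, π.cycleOf x = c → x < π (π x) → π (π x) < π x → CycleHasForm π c ![3, 1, 2] := by
      rintro x rfl h1 h2
      obtain ⟨f, h3, h4, h5⟩ := exists_orderEmbedding_fin_three h1 h2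
      refine ⟨f, ?_, ?_⟩
      · rw [support_cycleOf_of_cube h.cube h.ne]
        ext y
        simp only [Set.mem_range, Fin.exists_fin_succ, Finset.coe_insert, Finset.coe_singleton,
          Set.mem_insert_iff, Set.mem_singleton_iff]
        simp [h3, h4, h5, eq_comm]
        tauto
      · intro s t
        have := h.cube x
        fin_cases s <;> fin_cases t <;> simp [h3, h4, h5, h.cube] <;> omega
    obtain ⟨hcyc, -⟩ := Equiv.Perm.mem_cycleFactorsFinset_iff.1 hc
    obtain ⟨x, hx⟩ := hcyc.nonempty_support
    have hcx : π.cycleOf x = c := (Equiv.Perm.cycle_is_cycleOf hx hc).symm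
    have hcx1 : π.cycleOf (π x) = c := by
      rw [← hcx]
      exact (Equiv.Perm.SameCycle.cycleOf_eq ⟨1, by simp⟩).symm
    have hcx2 : π.cycleOf (π (π x)) = c := by
      rw [← hcx]
      exact (Equiv.Perm.SameCycle.cycleOf_eq ⟨2, by simp [sq]⟩).symm
    rcases h.exists_lt_lt x with h' | h' | h'
    · exact key _ hcx h'.1 h'.2
    · exact key _ hcx2 (by simpa [h.cube] using h'.1) (by simpa [h.cube] using h'.2)
    · exact key _ hcx1 (by simpa [h.cube] using h'.1) (by simpa [h.cube] using h'.2)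

theorem mem_A_iff {n : ℕ} {π : Equiv.Perm (Fin (3 * n))} :
    π ∈ A n ↔ AllCycles312 π ∧ Avoids132 π :=
  ⟨fun h => ⟨allCycles312_of_mem_A h, (avoidsPattern_one_three_two π).1 h.2.1⟩,
    fun h => h.1.mem_A h.2⟩

/-! ### Layouts -/

/-- `π` is described by the pair `(σ, f)`: its cycles are `α i ↦ γ i ↦ β i ↦ α i`, the smallest
elements `α i` of the cycles are `0, …, n - 1` with `α i = σ i`, the middle elements `β` and the
largest elements `γ` are listed increasingly, and they are shuffled according to `f`. -/
structure IsLayout {n : ℕ} (π : Equiv.Perm (Fin (3 * n))) (σ : Equiv.Perm (Fin n)) (f : Fin n → ℕ)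
    (α β γ : Fin n → Fin (3 * n)) : Prop where
  val_α : ∀ i, (α i : ℕ) = σ i
  β_mono : StrictMono β
  γ_mono : StrictMono γ
  le_β : ∀ i, n ≤ (β i : ℕ)
  le_γ : ∀ i, n ≤ (γ i : ℕ)
  le : ∀ i, f i ≤ n
  lt : ∀ i : Fin n, (i : ℕ) < f i
  β_lt_γ : ∀ i p, β i < γ p ↔ (i : ℕ) < f p
  apply_α : ∀ i, π (α i) = γ i
  apply_β : ∀ i, π (β i) = α i
  apply_γ : ∀ i, π (γ i) = β i
  cover : ∀ x, (∃ i, x = α i) ∨ (∃ i, x = β i) ∨ ∃ i, x = γ i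

namespace IsLayout

variable {n : ℕ} {π : Equiv.Perm (Fin (3 * n))} {σ : Equiv.Perm (Fin n)} {f : Fin n → ℕ}
  {α β γ : Fin n → Fin (3 * n)}

theorem α_lt (h : IsLayout π σ f α β γ) (i : Fin n) : (α i : ℕ) < n := by
  rw [h.val_α]
  exact (σ i).2

theorem α_lt_α (h : IsLayout π σ f α β γ) (i j : Fin n) : α i < α j ↔ σ i < σ j := by
  rw [Fin.lt_def, h.val_α, h.val_α, Fin.lt_def]

theorem α_lt_β (h : IsLayout π σ f α β γ) (i j : Fin n) : α i < β j :=
  Fin.lt_def.2 ((h.α_lt i).trans_le (h.le_β j))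

theorem α_lt_γ (h : IsLayout π σ f α β γ) (i j : Fin n) : α i < γ j :=
  Fin.lt_def.2 ((h.α_lt i).trans_le (h.le_γ j))

theorem β_ne_γ (h : IsLayout π σ f α β γ) (i j : Fin n) : β i ≠ γ j := by
  intro he
  have := h.apply_β i
  rw [he, h.apply_γ] at this
  exact (h.α_lt_β i j).ne' this

theorem γ_lt_β (h : IsLayout π σ f α β γ) (i p : Fin n) : γ p < β i ↔ f p ≤ i := by
  have := h.β_lt_γ i p
  have := h.β_ne_γ i p
  omega

theorem f_monotone (h : IsLayout π σ f α β γ) : Monotone f := by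
  intro p q hpq
  by_contra hlt
  have hn : f q < n := by have := h.le p; omega
  have h1 := (h.β_lt_γ ⟨f q, hn⟩ p).2 (by simpa using hlt)
  have h2 := (h.β_lt_γ ⟨f q, hn⟩ q).1 (h1.trans_le (h.γ_mono.monotone hpq))
  simp at h2

theorem allCycles312 (h : IsLayout π σ f α β γ) : AllCycles312 π := by
  have hβγ : ∀ i, β i < γ i := fun i => (h.β_lt_γ i i).2 (h.lt i)
  refine ⟨fun x => ?_, fun x => ?_, fun x => ?_⟩ <;>
  rcases h.cover x with ⟨i, rfl⟩ | ⟨i, rfl⟩ | ⟨i, rfl⟩ <;>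
  simp only [h.apply_α, h.apply_β, h.apply_γ]
  · exact (h.α_lt_γ i i).ne'
  · exact (h.α_lt_β i i).ne
  · exact (hβγ i).ne
  · exact fun _ => (hβγ i).asymm
  · exact fun h1 => absurd h1 (h.α_lt_β i i).asymm
  · exact fun h1 => absurd h1 (hβγ i).asymm

/-- Each failure yields a 132: one in σ reappears at the β's; f p < f q for a non-inversion gives
one at α p, α q and the β-valued position γ (f p); a non-inversion split by f r gives one at β p, γ
r, β q. -/
theorem isAdmissible (h : IsLayout π σ f α β γ) (hav : Avoids132 π) : IsAdmissible σ f := by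
  refine ⟨fun i j k hij hjk h1 h2 => ?_, h.f_monotone, h.lt, h.le, fun p q hpq hσ => ?_,
    fun r p q hpq hσ hs => ?_⟩
  · refine hav (β i) (β j) (β k) (h.β_mono hij) (h.β_mono hjk) ?_ ?_ <;>
    rwa [h.apply_β, h.apply_β, h.α_lt_α]
  · by_contra hne
    have hlt : f p < f q := lt_of_le_of_ne (h.f_monotone hpq.le) hne
    have hn : f p < n := by have := h.le q; omega
    refine hav (α p) (α q) (γ ⟨f p, hn⟩) ((h.α_lt_α p q).2 hσ) (h.α_lt_γ _ _) ?_ ?_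
    · rw [h.apply_α, h.apply_γ, h.γ_lt_β]
    · rwa [h.apply_α, h.apply_γ, h.β_lt_γ]
  · refine hav (β p) (γ r) (β q) ((h.β_lt_γ p r).2 hs.1) ((h.γ_lt_β q r).2 hs.2) ?_ ?_
    · rwa [h.apply_β, h.apply_β, h.α_lt_α]
    · rw [h.apply_β, h.apply_γ]
      exact h.α_lt_β _ _

theorem avoids132 (h : IsLayout π σ f α β γ) (ha : IsAdmissible σ f) : Avoids132 π := by
  intro i j k hij hjk h1 h2
  have hγγ : ∀ r s, γ r < γ s → ¬ β s < β r := fun r s hrs =>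
    (h.β_mono (h.γ_mono.lt_iff_lt.1 hrs)).asymm
  rcases h.cover i with ⟨p, rfl⟩ | ⟨p, rfl⟩ | ⟨p, rfl⟩ <;>
  rcases h.cover j with ⟨q, rfl⟩ | ⟨q, rfl⟩ | ⟨q, rfl⟩ <;>
  rcases h.cover k with ⟨s, rfl⟩ | ⟨s, rfl⟩ | ⟨s, rfl⟩ <;>
  simp only [h.apply_α, h.apply_β, h.apply_γ] at h1 h2 <;>
  have := h.α_lt p <;> have := h.α_lt q <;> have := h.α_lt s <;>
  have := h.le_β p <;> have := h.le_β q <;> have := h.le_β s <;>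
  have := h.le_γ p <;> have := h.le_γ q <;> have := h.le_γ s <;>
  have := hγγ q s <;> try omega
  -- Size comparisons leave four shapes: ααα, ααγ, βββ, βγβ. In this one the pattern is read in the
  -- inverse of σ, and 132 is its own inverse.
  · rw [h.α_lt_α] at hij hjk
    exact ha.avoids p s q (h.γ_mono.lt_iff_lt.1 h1) (h.γ_mono.lt_iff_lt.1 h2) hij hjk
  · rw [h.α_lt_α] at hij
    have he := ha.eq p q (h.γ_mono.lt_iff_lt.1 (h1.trans h2)) hij
    rw [h.γ_lt_β] at h1
    rw [h.β_lt_γ] at h2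
    omega
  · rw [h.α_lt_α] at h1 h2
    exact ha.avoids p q s (h.β_mono.lt_iff_lt.1 hij) (h.β_mono.lt_iff_lt.1 hjk) h1 h2
  · rw [h.α_lt_α] at h1
    exact ha.isCut q p s (h.β_mono.lt_iff_lt.1 (hij.trans hjk)) h1
      ⟨(h.β_lt_γ _ _).1 hij, (h.γ_lt_β _ _).1 hjk⟩

/-- The maxima of the cycles depend on π alone, and listing them increasingly fixes γ, then β, α, σ
and f. -/
theorem pair_unique {σ' : Equiv.Perm (Fin n)} {f' : Fin n → ℕ} {α' β' γ' : Fin n → Fin (3 * n)}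
    (h : IsLayout π σ f α β γ) (h' : IsLayout π σ' f' α' β' γ') : σ = σ' ∧ f = f' := by
  have hr : ∀ {σ f α β γ}, IsLayout π σ f α β γ →
      Set.range γ = {x | π x < x ∧ π (π x) < π x} := by
    intro σ f α β γ h
    ext x
    have hβγ : ∀ i, β i < γ i := fun i => (h.β_lt_γ i i).2 (h.lt i)
    constructor
    · rintro ⟨i, rfl⟩
      simp only [Set.mem_ofPred_eq, h.apply_γ, h.apply_β]
      exact ⟨hβγ i, h.α_lt_β i i⟩
    · rintro ⟨h1, h2⟩
      rcases h.cover x with ⟨i, rfl⟩ | ⟨i, rfl⟩ | ⟨i, rfl⟩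
      · rw [h.apply_α] at h1
        exact absurd h1 (h.α_lt_γ i i).asymm
      · rw [h.apply_β, h.apply_α] at h2
        exact absurd h2 (h.α_lt_γ i i).asymm
      · exact ⟨i, rfl⟩
  have hγ : γ = γ' := (StrictMono.range_inj h.γ_mono h'.γ_mono).1 ((hr h).trans (hr h').symm)
  subst hγ
  have hβ : ∀ i, β i = β' i := fun i => by rw [← h.apply_γ, h'.apply_γ]
  refine ⟨Equiv.ext fun i => Fin.ext ?_, funext fun p => ?_⟩
  · rw [← h.val_α, ← h'.val_α, ← h.apply_β, ← h'.apply_β, hβ]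
  · have h1 := h.le p
    have h2 := h'.le p
    have h3 : ∀ i : Fin n, (i : ℕ) < f p ↔ (i : ℕ) < f' p := fun i => by
      rw [← h.β_lt_γ, ← h'.β_lt_γ, hβ]
    by_contra hne
    rcases lt_or_gt_of_ne hne with hlt | hlt
    · have := h3 ⟨f p, by omega⟩
      simp at this
      omega
    · have := h3 ⟨f' p, by omega⟩
      simp at this
      omega

/-- The elements of the cycles of a layout. -/
def point (α β γ : Fin n → Fin (3 * n)) (u : Fin n × Fin 3) : Fin (3 * n) :=
  ![α u.1, β u.1, γ u.1] u.2

theorem point_surjective (h : IsLayout π σ f α β γ) : Function.Surjective (point α β γ) := by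
  intro x
  rcases h.cover x with ⟨i, rfl⟩ | ⟨i, rfl⟩ | ⟨i, rfl⟩
  exacts [⟨(i, 0), rfl⟩, ⟨(i, 1), rfl⟩, ⟨(i, 2), rfl⟩]

theorem point_bijective (h : IsLayout π σ f α β γ) : Function.Bijective (point α β γ) := by
  rw [Fintype.bijective_iff_surjective_and_card]
  exact ⟨h.point_surjective, by simp [mul_comm]⟩

theorem point_lt_point {π' : Equiv.Perm (Fin (3 * n))} {α' β' γ' : Fin n → Fin (3 * n)}
    (h : IsLayout π σ f α β γ) (h' : IsLayout π' σ f α' β' γ') (u v : Fin n × Fin 3)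
    (huv : point α β γ u < point α β γ v) : point α' β' γ' u < point α' β' γ' v := by
  obtain ⟨i, s⟩ := u
  obtain ⟨j, t⟩ := v
  fin_cases s <;> fin_cases t <;>
  simp only [point, Fin.mk_one, Fin.zero_eta, Fin.isValue, Matrix.cons_val_zero, Matrix.cons_val_one,
    Matrix.cons_val, Fin.reduceFinMk] at huv ⊢
  · rwa [h.α_lt_α, ← h'.α_lt_α] at huv
  · exact h'.α_lt_β _ _
  · exact h'.α_lt_γ _ _
  · exact absurd huv (h.α_lt_β _ _).asymm
  · exact h'.β_mono (h.β_mono.lt_iff_lt.1 huv)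
  · rwa [h.β_lt_γ, ← h'.β_lt_γ] at huv
  · exact absurd huv (h.α_lt_γ _ _).asymm
  · rwa [h.γ_lt_β, ← h'.γ_lt_β] at huv
  · exact h'.γ_mono (h.γ_mono.lt_iff_lt.1 huv)

/-- The relative order of all 3n points depends only on (σ, f), so matching the points of two
layouts is an order automorphism of a finite chain, hence the identity. -/
theorem perm_unique {π' : Equiv.Perm (Fin (3 * n))} {α' β' γ' : Fin n → Fin (3 * n)}
    (h : IsLayout π σ f α β γ) (h' : IsLayout π' σ f α' β' γ') : π = π' := by
  let e := Equiv.ofBijective _ h.point_bijective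
  have hmono : StrictMono fun x => point α' β' γ' (e.symm x) := by
    intro x y hxy
    refine h.point_lt_point h' _ _ ?_
    have : ∀ z, point α β γ (e.symm z) = z := e.apply_symm_apply
    rwa [this, this]
  have hid : (fun x => point α' β' γ' (e.symm x)) = id := by
    refine (StrictMono.range_inj hmono strictMono_id).1 ?_
    rw [Set.range_id, Set.range_eq_univ]
    exact h'.point_surjective.comp e.symm.surjective
  have hp : ∀ u, point α' β' γ' u = point α β γ u := by
    intro u
    have := congrFun hid (e u)
    rwa [e.symm_apply_apply] at this
  have hα : ∀ i, α' i = α i := fun i => hp (i, 0)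
  have hβ : ∀ i, β' i = β i := fun i => hp (i, 1)
  have hγ : ∀ i, γ' i = γ i := fun i => hp (i, 2)
  ext x
  rcases h.cover x with ⟨i, rfl⟩ | ⟨i, rfl⟩ | ⟨i, rfl⟩
  · rw [h.apply_α, ← hα, h'.apply_α, hγ]
  · rw [h.apply_β, ← hβ, h'.apply_β, hα]
  · rw [h.apply_γ, ← hγ, h'.apply_γ, hβ]

end IsLayout

/-! ### Existence of layouts, from permutations and from admissible pairs -/

theorem Fin.mem_iff_lt_card_of_isLowerSet {N : ℕ} {S : Finset (Fin N)}
    (hS : ∀ x y, x ≤ y → y ∈ S → x ∈ S) (x : Fin N) : x ∈ S ↔ (x : ℕ) < S.card := by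
  constructor
  · intro hx
    have : Finset.Iic x ⊆ S := fun y hy => hS y x (Finset.mem_Iic.1 hy) hx
    have := Finset.card_le_card this
    rw [Fin.card_Iic] at this
    omega
  · intro hx
    by_contra hn
    have : S ⊆ Finset.Iio x := fun y hy => by
      rw [Finset.mem_Iio]
      by_contra hxy
      exact hn (hS x y (not_lt.1 hxy) hy)
    have := Finset.card_le_card this
    rw [Fin.card_Iio] at this
    omega

/-- The largest elements of the cycles. -/
def cycleMaxima {N : ℕ} (π : Equiv.Perm (Fin N)) : Finset (Fin N) :=
  Finset.univ.filter fun x => π x < x ∧ π (π x) < π x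

namespace AllCycles312

variable {n N : ℕ}

theorem card_cycleMaxima {π : Equiv.Perm (Fin (3 * n))} (h : AllCycles312 π) :
    (cycleMaxima π).card = n := by
  -- Exactly one of x, π x, π (π x) is a maximum, so summing over x counts each maximum three times.
  have h1 : ∑ x, (((if x ∈ cycleMaxima π then 1 else 0) + if π x ∈ cycleMaxima π then 1 else 0) +
      if π (π x) ∈ cycleMaxima π then 1 else 0) = ∑ x : Fin (3 * n), 1 := by
    refine Finset.sum_congr rfl fun x _ => ?_
    have := h.exists_lt_lt x
    simp only [cycleMaxima, Finset.mem_filter, Finset.mem_univ, true_and, h.cube]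
    split_ifs <;> omega
  rw [Finset.sum_add_distrib, Finset.sum_add_distrib,
    Equiv.sum_comp π fun x => if x ∈ cycleMaxima π then 1 else 0,
    Equiv.sum_comp π fun x => if π x ∈ cycleMaxima π then 1 else 0,
    Equiv.sum_comp π fun x => if x ∈ cycleMaxima π then 1 else 0] at h1
  simp at h1
  omega

/-- A minimum y after a non-minimum x would give a 132 at x, y and the middle element π (π y), with
values π x < y < π y. -/
theorem lt_of_avoids132 {π : Equiv.Perm (Fin N)} (h : AllCycles312 π) (hav : Avoids132 π)
    {x y : Fin N} (hx : π x < x) (hy : y < π y) : y < x := by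
  by_contra hxy
  have hne : x ≠ y := by
    rintro rfl
    exact hx.asymm hy
  have h1 : y < π (π y) := by
    have := h.exists_lt_lt y
    omega
  refine hav x y (π (π y)) (by omega) h1 ?_ ?_
  · rw [h.cube]
    omega
  · rwa [h.cube]

theorem lt_apply_iff {π : Equiv.Perm (Fin (3 * n))} (h : AllCycles312 π) (hav : Avoids132 π)
    (x : Fin (3 * n)) : x < π x ↔ (x : ℕ) < n := by
  have hc : (Finset.univ.filter fun x => x < π x).card = n := by
    refine Eq.trans ?_ h.card_cycleMaxima
    refine Finset.card_bij (fun x _ => π x) ?_ (fun _ _ _ _ he => π.injective he) ?_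
    · intro x hx
      simp only [cycleMaxima, Finset.mem_filter, Finset.mem_univ, true_and, h.cube] at hx ⊢
      have := h.exists_lt_lt x
      omega
    · intro x hx
      refine ⟨π (π x), ?_, h.cube x⟩
      simp only [cycleMaxima, Finset.mem_filter, Finset.mem_univ, true_and, h.cube] at hx ⊢
      omega
  have := Fin.mem_iff_lt_card_of_isLowerSet (S := Finset.univ.filter fun x => x < π x) ?_ x
  · simpa [hc] using this
  · intro x y hxy hy
    simp only [Finset.mem_filter, Finset.mem_univ, true_and] at hy ⊢
    by_contra hx
    have := h.ne x
    have := h.lt_of_avoids132 hav (x := x) (by omega) hy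
    omega

theorem exists_isLayout {π : Equiv.Perm (Fin (3 * n))} (h : AllCycles312 π) (hav : Avoids132 π) :
    ∃ σ f α β γ, IsLayout π σ f α β γ := by
  let γ := (cycleMaxima π).orderEmbOfFin h.card_cycleMaxima
  have hγ : ∀ i, π (γ i) < γ i ∧ π (π (γ i)) < π (γ i) := fun i => by
    have := (cycleMaxima π).orderEmbOfFin_mem h.card_cycleMaxima i
    exact (Finset.mem_filter.1 this).2
  have hrange : ∀ x, π x < x → π (π x) < π x → ∃ i, x = γ i := fun x h1 h2 => by
    have : x ∈ Set.range γ := by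
      rw [Finset.range_orderEmbOfFin]
      simp [cycleMaxima, h1, h2]
    obtain ⟨i, hi⟩ := this
    exact ⟨i, hi.symm⟩
  have hα : ∀ i, ((π (π (γ i)) : Fin (3 * n)) : ℕ) < n := fun i => by
    rw [← h.lt_apply_iff hav, h.cube]
    exact (hγ i).2.trans (hγ i).1
  have hβn : ∀ i, n ≤ ((π (γ i) : Fin (3 * n)) : ℕ) := fun i => by
    have h1 := h.lt_apply_iff hav (π (γ i))
    have := hγ i
    omega
  have hγn : ∀ i, n ≤ (γ i : ℕ) := fun i => by
    have h1 := h.lt_apply_iff hav (γ i)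
    have := hγ i
    omega
  have hσ : Function.Bijective fun i => (⟨π (π (γ i)), hα i⟩ : Fin n) := by
    rw [← Finite.injective_iff_bijective]
    intro i j hij
    exact γ.injective (π.injective (π.injective (Fin.ext (Fin.mk.inj_iff.1 hij))))
  have hβ : StrictMono fun i => π (γ i) := by
    intro i j hij
    have hij' : γ i < γ j := γ.strictMono hij
    by_contra hle
    have hne : π (γ j) ≠ π (γ i) := fun he => hij'.ne' (π.injective he)
    have h1 := hα i
    have h2 := hβn j
    -- If β decreased from i to j, positions β i < γ i < γ j would carry α i < β j < β i, a 132.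
    refine hav (π (γ i)) (γ i) (γ j) (hγ i).1 hij' (by omega) (by simp only at hle; omega)
  let f : Fin n → ℕ := fun p => (Finset.univ.filter fun i => π (γ i) < γ p).card
  have hf : ∀ i p, π (γ i) < γ p ↔ (i : ℕ) < f p := fun i p => by
    rw [← Fin.mem_iff_lt_card_of_isLowerSet (S := Finset.univ.filter fun i => π (γ i) < γ p)]
    · simp
    · intro x y hxy hy
      simp only [Finset.mem_filter, Finset.mem_univ, true_and] at hy ⊢
      exact (hβ.monotone hxy).trans_lt hy
  refine ⟨Equiv.ofBijective _ hσ, f, fun i => π (π (γ i)), fun i => π (γ i), γ, ?_⟩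
  refine ⟨fun i => rfl, hβ, γ.strictMono, hβn, hγn, fun p => ?_, fun p => (hf p p).1 (hγ p).1, hf,
    fun i => h.cube _, fun i => rfl, fun i => rfl, fun x => ?_⟩
  · exact (Finset.card_le_univ _).trans_eq (Fintype.card_fin n)
  · rcases h.exists_lt_lt x with h' | h' | h'
    · obtain ⟨i, hi⟩ := hrange (π x) h'.2 (by rw [h.cube]; exact h'.1)
      exact Or.inl ⟨i, by rw [← hi, h.cube]⟩
    · obtain ⟨i, hi⟩ := hrange x h'.2 h'.1
      exact Or.inr (Or.inr ⟨i, hi⟩)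
    · obtain ⟨i, hi⟩ := hrange (π (π x)) (by rw [h.cube]; exact h'.2)
        (by rw [h.cube, h.cube]; exact h'.1)
      exact Or.inr (Or.inl ⟨i, by rw [← hi, h.cube]⟩)

end AllCycles312

theorem IsAdmissible.exists_isLayout {n : ℕ} {σ : Equiv.Perm (Fin n)} {f : Fin n → ℕ}
    (h : IsAdmissible σ f) : ∃ π α β γ, IsLayout π σ f α β γ := by
  let cnt : ℕ → ℕ := fun i => (Finset.univ.filter fun q => f q ≤ i).card
  have hcnt : ∀ i, cnt i ≤ n := fun i => (Finset.card_le_univ _).trans_eq (Fintype.card_fin n)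
  have hcm : Monotone cnt := fun i j hij =>
    Finset.card_le_card fun q => by simpa using fun hq => hq.trans hij
  have hlt : ∀ (i : ℕ) (p : Fin n), (p : ℕ) < cnt i ↔ f p ≤ i := fun i p => by
    rw [← Fin.mem_iff_lt_card_of_isLowerSet (S := Finset.univ.filter fun q => f q ≤ i)]
    · simp
    · intro x y hxy hy
      simp only [Finset.mem_filter, Finset.mem_univ, true_and] at hy ⊢
      exact (h.monotone hxy).trans hy
  let α : Fin n → Fin (3 * n) := fun i => ⟨σ i, by have := (σ i).2; omega⟩
  -- Before β i come the n minima, i middle elements and the `cnt i` maxima with f q ≤ i; before γ i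
  -- come the n minima, i maxima and f i middle elements.
  let β : Fin n → Fin (3 * n) := fun i => ⟨n + i + cnt i, by have := hcnt i; omega⟩
  let γ : Fin n → Fin (3 * n) := fun i => ⟨n + i + f i, by have := h.le i; omega⟩
  have hα : ∀ i, (α i : ℕ) = σ i := fun i => rfl
  have hβ : ∀ i, (β i : ℕ) = n + i + cnt i := fun i => rfl
  have hγ : ∀ i, (γ i : ℕ) = n + i + f i := fun i => rfl
  have hβm : StrictMono β := fun i j hij => by
    have := hcm hij.le
    have := hβ i
    have := hβ j
    omega
  have hγm : StrictMono γ := fun i j hij => by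
    have := h.monotone hij.le
    have := hγ i
    have := hγ j
    omega
  have hβγ : ∀ i p, β i < γ p ↔ (i : ℕ) < f p := fun i p => by
    have := hlt i p
    have := hβ i
    have := hγ p
    omega
  have hβγ' : ∀ i p, β i ≠ γ p := fun i p => by
    have := hlt i p
    have := hβ i
    have := hγ p
    omega
  have hαβ : ∀ i p, α i ≠ β p := fun i p => by
    have := (σ i).2
    have := hα i
    have := hβ p
    omega
  have hαγ : ∀ i p, α i ≠ γ p := fun i p => by
    have := (σ i).2
    have := hα i
    have := hγ p
    omega
  have hinj : Function.Injective (IsLayout.point α β γ) := by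
    rintro ⟨i, s⟩ ⟨j, t⟩ huv
    fin_cases s <;> fin_cases t <;>
    simp only [IsLayout.point, Fin.mk_one, Fin.zero_eta, Fin.isValue, Matrix.cons_val_zero,
      Matrix.cons_val_one, Matrix.cons_val, Fin.reduceFinMk] at huv ⊢
    · rw [σ.injective (Fin.ext (Fin.mk.inj_iff.1 huv))]
    · exact absurd huv (hαβ i j)
    · exact absurd huv (hαγ i j)
    · exact absurd huv.symm (hαβ j i)
    · rw [hβm.injective huv]
    · exact absurd huv (hβγ' i j)
    · exact absurd huv.symm (hαγ j i)
    · exact absurd huv.symm (hβγ' j i)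
    · rw [hγm.injective huv]
  let e := Equiv.ofBijective _ ((Fintype.bijective_iff_injective_and_card _).2
    ⟨hinj, by simp [mul_comm]⟩)
  let π : Equiv.Perm (Fin (3 * n)) :=
    -- Subtracting 1 modulo 3 from the index of α, β, γ realises α ↦ γ ↦ β ↦ α.
    e.symm.trans ((Equiv.prodCongr (Equiv.refl _) (Equiv.subRight 1)).trans e)
  have hπ : ∀ i s, π (IsLayout.point α β γ (i, s)) = IsLayout.point α β γ (i, s - 1) := by
    intro i s
    have : e.symm (IsLayout.point α β γ (i, s)) = (i, s) := e.symm_apply_apply _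
    simp only [π, Equiv.trans_apply, this]
    rfl
  refine ⟨π, α, β, γ, hα, hβm, hγm, fun i => ?_, fun i => ?_, h.le, h.lt, hβγ, fun i => hπ i 0,
    fun i => hπ i 1, fun i => hπ i 2, fun x => ?_⟩
  · have := hβ i
    omega
  · have := hγ i
    omega
  · obtain ⟨⟨i, s⟩, rfl⟩ := e.surjective x
    fin_cases s
    exacts [Or.inl ⟨i, rfl⟩, Or.inr (Or.inl ⟨i, rfl⟩), Or.inr (Or.inr ⟨i, rfl⟩)]

theorem ncard_A (n : ℕ) : (A n).ncard = (admissiblePairs n).card := by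
  have hA : ∀ π ∈ A n, ∃ x : Equiv.Perm (Fin n) × (Fin n → ℕ), ∃ α β γ,
      IsLayout π x.1 x.2 α β γ := fun π hπ => by
    obtain ⟨h1, h2⟩ := mem_A_iff.1 hπ
    obtain ⟨σ, f, α, β, γ, h⟩ := h1.exists_isLayout h2
    exact ⟨(σ, f), α, β, γ, h⟩
  choose! Ψ α β γ hΨ using hA
  rw [← Set.ncard_coe_finset]
  refine Set.ncard_congr (fun π _ => Ψ π) ?_ ?_ ?_
  · intro π hπ
    exact mem_admissiblePairs.2 ((hΨ π hπ).isAdmissible (mem_A_iff.1 hπ).2)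
  · intro π π' hπ hπ' he
    have h := hΨ π hπ
    rw [he] at h
    exact h.perm_unique (hΨ π' hπ')
  · intro x hx
    have hx := mem_admissiblePairs.1 hx
    obtain ⟨π, α', β', γ', h⟩ := hx.exists_isLayout
    have hπ : π ∈ A n := mem_A_iff.2 ⟨h.allCycles312, h.avoids132 hx⟩
    obtain ⟨h1, h2⟩ := (hΨ π hπ).pair_unique h
    exact ⟨π, hπ, Prod.ext h1 h2⟩

theorem mainTheorem3 :
    (∀ n : ℕ, 1 ≤ n →
      (A n).ncard =
        ∑ k ∈ Finset.Icc 1 n, motzkin (k - 1) *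
          ∑ X ∈ compositionsOfLength n k, (X.blocks.map catalan).prod) ∧
    AGF = (catalanGF - 1) * PowerSeries.subst (catalanGF - 1) motzkinGF := by
  have h : ∀ n : ℕ, 1 ≤ n → ((A n).ncard : ℤ) = PowerSeries.coeff n treeGF := by
    intro n hn
    rw [ncard_A, card_admissiblePairs, map_add, PowerSeries.coeff_one, if_neg (by omega), zero_add]
  refine ⟨fun n hn => ?_, ?_⟩
  · have := h n hn
    rw [coeff_treeGF] at this
    exact_mod_cast this
  · change AGF = treeGF
    ext n
    rw [AGF, PowerSeries.coeff_mk]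
    split_ifs with h0
    · rw [h0, coeff_zero_treeGF]
    · exact h n (by omega)
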